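/- All systems are finite-dimensional Hilbert spaces with fixed standard bases, $|X|$ denotes the dimension of $X$, and logarithms are to base $2$. Let $\mathcal S(X)$ be the set of positive semidefinite operators on $X$ with trace $1$, and $\mathcal S_\le(X)$ the set of those with trace at most $1$. For $\rho,\sigma\in\mathcal S_\le(X)$ let $$P(\rho,\sigma)=\sqrt{1-\bar F(\rho,\sigma)^2},\qquad \bar F(\rho,\sigma)=\|\sqrt\rho\sqrt\sigma\|_1+\sqrt{(1-\mathrm{tr}\,\rho)(1-\mathrm{tr}\,\sigma)},$$ where $\|M\|_1=\mathrm{tr}\sqrt{M^\dagger M}$. For $\delta\ge 0$ define $$H_{\min}(X|Y)_\rho=\sup_{\sigma_Y\in\mathcal S(Y)}\sup\{\lambda\in\mathbb R:\ \rho_{XY}\le 2^{-\lambda}\,\mathbb I_X\otimes\sigma_Y\},\qquad H_{\min}^{\delta}(X|Y)_\rho=\sup\{H_{\min}(X|Y)_{\tilde\rho}:\ \tilde\rho\in\mathcal S_\le(XY),\ P(\rho,\tilde\rho)\le\delta\},$$ with values in $[-\infty,+\infty]$. Let $A=A_1A_2$, let $\mathcal T_{A\to A_1}(\cdot)=\sum_{a_1,a_2}\langle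 a_1a_2|\cdot|a_1a_2\rangle\,|a_1\rangle\langle a_1|$ be the map that traces out $A_2$ and measures $A_1$ in its standard basis, and let $\{U_1,\dots,U_L\}$ with $L\ge 1$ be unitaries on $A$ (both extended to $AE$ by the identity on $E$). Let $\rho_{AE}\in\mathcal S(AE)$, $\rho_E=\mathrm{tr}_A\,\rho_{AE}$ and $\varepsilon\in\mathbb R$. If $$\frac1L\sum_{i=1}^L\Big\|\mathcal T_{A\to A_1}\big(U_i\rho_{AE}U_i^\dagger\big)-\frac{\mathbb I_{A_1}}{|A_1|}\otimes\rho_E\Big\|_1\le\varepsilon ,\qquad(*)$$ then $$\log|A_1|\le\log|A|+H_{\min}^{\sqrt\varepsilon}(A|E)_\rho .\qquad(**)$$ In particular, let $k\in[-\log|A|,\log|A|]$ and $\varepsilon\in[0,1]$, and suppose that $\{U_1,\dots,U_L\}$ is a $(k,\varepsilon)$-QC-extractor, i.e. that $(*)$ holds for every finite-dimensional system $E$ and every state $\rho_{AE}\in\mathcal S(AE)$ with $H_{\min}(A|E)_\rho\ge k$. Then $(**)$ holds for every such state. -/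

import Mathlib

open scoped Matrix Kronecker ComplexOrder MatrixOrder

universe u v w

noncomputable section

namespace QInfo

variable {X : Type u} {Y : Type v} [Fintype X] [DecidableEq X] [Fintype Y] [DecidableEq Y]

/- Finite-dimensional systems are represented by finite types indexing their standard
orthonormal bases; an operator on the system `X` is a matrix `Matrix X X ℂ`, and the composite
system of `X` and `Y` is indexed by `X × Y`. -/

/-- Normalized states (density operators). -/
def IsState (ρ : Matrix X X ℂ) : Prop :=
  ρ.PosSemidef ∧ ρ.trace = 1

/-- Sub-normalized states. -/
def IsSubState (ρ : Matrix X X ℂ) : Prop :=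
  ρ.PosSemidef ∧ ρ.trace.re ≤ 1

/-- The trace norm `‖M‖₁ = tr √(M† M)`. -/
def traceNorm (M : Matrix X X ℂ) : ℝ :=
  (CFC.sqrt (Mᴴ * M)).trace.re

/-- The fidelity `F(ρ, σ) = ‖√ρ √σ‖₁`. -/
def fidelity (ρ σ : Matrix X X ℂ) : ℝ :=
  traceNorm (CFC.sqrt ρ * CFC.sqrt σ)

/-- The generalized fidelity `F(ρ, σ) + √((1 - tr ρ) (1 - tr σ))` of sub-normalized states. -/
def genFidelity (ρ σ : Matrix X X ℂ) : ℝ :=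
  fidelity ρ σ + Real.sqrt ((1 - ρ.trace.re) * (1 - σ.trace.re))

/-- The purified distance of sub-normalized states. -/
def purifiedDist (ρ σ : Matrix X X ℂ) : ℝ :=
  Real.sqrt (1 - genFidelity ρ σ ^ 2)

/-- The ball of sub-normalized states around `ρ` in purified distance. -/
def stateBall (δ : ℝ) (ρ : Matrix X X ℂ) : Set (Matrix X X ℂ) :=
  {σ | IsSubState σ ∧ purifiedDist ρ σ ≤ δ}

/-- The min-entropy of `ρ` on `XY` relative to `σ` on `Y`: the largest real `l` such that
`2 ^ (-l) • 1 ⊗ σ ≥ ρ` (`-∞` if there is none, `+∞` if they are unbounded). -/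
def minEntropyRel (ρ : Matrix (X × Y) (X × Y) ℂ) (σ : Matrix Y Y ℂ) : EReal :=
  ⨆ (l : ℝ) (_ : ρ ≤ ((2 : ℝ) ^ (-l)) • ((1 : Matrix X X ℂ) ⊗ₖ σ)), (l : EReal)

/-- The conditional min-entropy `H_min(X|Y)_ρ`, where `σ` runs over the normalized states on
`Y`. -/
def minEntropy (ρ : Matrix (X × Y) (X × Y) ℂ) : EReal :=
  ⨆ (σ : Matrix Y Y ℂ) (_ : IsState σ), minEntropyRel ρ σ

/-- The smooth conditional min-entropy `H_min^δ(X|Y)_ρ`. -/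
def smoothMinEntropy (δ : ℝ) (ρ : Matrix (X × Y) (X × Y) ℂ) : EReal :=
  ⨆ (τ : Matrix (X × Y) (X × Y) ℂ) (_ : τ ∈ stateBall δ ρ), minEntropy τ

/-- The reduced operator on `Y` of an operator on `XY` (partial trace over `X`). -/
def reduced (ρ : Matrix (X × Y) (X × Y) ℂ) : Matrix Y Y ℂ :=
  Matrix.of fun y y' => ∑ x, ρ (x, y) (x, y')

variable {A₁ : Type u} {A₂ : Type v} {E : Type w} [Fintype A₁] [DecidableEq A₁]
  [Fintype A₂] [DecidableEq A₂] [Fintype E] [DecidableEq E]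

/-- The measurement map `M ↦ ∑ a₁ a₂, ⟨a₁ a₂| M |a₁ a₂⟩ |a₁⟩⟨a₁|` from `A₁A₂` to `A₁`, applied
to an operator on `A₁A₂E` and acting as the identity on `E`: trace out `A₂`, then measure `A₁` in
its standard basis. -/
def measure (M : Matrix ((A₁ × A₂) × E) ((A₁ × A₂) × E) ℂ) : Matrix (A₁ × E) (A₁ × E) ℂ :=
  Matrix.of fun p q =>
    if p.1 = q.1 then ∑ a₂, M ((p.1, a₂), p.2) ((q.1, a₂), q.2) else 0

/-- `U ρ U†`, where `U` is a unitary on `X` and acts as the identity on `Y`. -/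
def applyUnitary (U : Matrix.unitaryGroup X ℂ) (ρ : Matrix (X × Y) (X × Y) ℂ) :
    Matrix (X × Y) (X × Y) ℂ :=
  ((U : Matrix X X ℂ) ⊗ₖ (1 : Matrix Y Y ℂ)) * ρ * ((U : Matrix X X ℂ) ⊗ₖ (1 : Matrix Y Y ℂ))ᴴ

/-- The average over `i` of the trace-norm distance of the outcome of applying `U i` to `ρ` and
measuring `A₁`, from the ideal operator `1 / |A₁| ⊗ ρ_E`. -/
def extractionError {L : ℕ} (U : Fin L → Matrix.unitaryGroup (A₁ × A₂) ℂ)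
    (ρ : Matrix ((A₁ × A₂) × E) ((A₁ × A₂) × E) ℂ) : ℝ :=
  (1 / (L : ℝ)) * ∑ i, traceNorm (measure (applyUnitary (U i) ρ) -
    ((1 / (Fintype.card A₁ : ℂ)) • (1 : Matrix A₁ A₁ ℂ)) ⊗ₖ reduced ρ)

/-- A nonempty finite family of unitaries on `A = A₁A₂` is a `(k, ε)`-QC-extractor with output
`A₁`: the average error is at most `ε` for every finite-dimensional system `E` and every state
on `AE` whose conditional min-entropy is at least `k`. -/
def IsQCExtractor (k ε : ℝ) {L : ℕ} (U : Fin L → Matrix.unitaryGroup (A₁ × A₂) ℂ) : Prop :=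
  0 < L ∧ |k| ≤ Real.logb 2 (Fintype.card (A₁ × A₂)) ∧ 0 ≤ ε ∧ ε ≤ 1 ∧
    ∀ (E : Type w) [Fintype E] [DecidableEq E]
      (ρ : Matrix ((A₁ × A₂) × E) ((A₁ × A₂) × E) ℂ),
      IsState ρ → (k : EReal) ≤ minEntropy ρ → extractionError U ρ ≤ ε

end QInfo

end

set_option linter.unusedSectionVars false

namespace QInfo

variable {X : Type u} {Y : Type v} [Fintype X] [DecidableEq X] [Fintype Y] [DecidableEq Y]

/-! Some `U i` has error at most `ε`. Let `ω a` be the blocks on `E` of its measured state and `τ =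
ρ_E / |A₁|` the ideal block. Powers–Størmer gives `∑ a, tr (√τ √(ω a)) ≥ 1 - ε/2`. With `k a = √τ (ω
a)^(-1/2)` (pseudo-inverse), the Kraus operator `K = ∑ |a b⟩⟨a b| ⊗ k a` acts on the rotated state,
still written `ρ`. The blocks of `K ρ K†` with fixed `a` sum to at most `τ`, so each is at most `τ`.
Pinching costs a factor `|A|`, whence `K ρ K† ≤ |A| • 1 ⊗ τ = |A₂| • 1 ⊗ ρ_E`, which is min-entropy
at least `-log |A₂|`. Closeness needs no purification: the fidelity of `ρ` and `K ρ K†` is at least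
`Re tr (K ρ) = ∑ a, tr (√τ √(ω a))`, and `1 - (1 - ε/2)² ≤ ε`. Undoing `U i` preserves all of this.
-/

/-! ### Square roots, partial isometries and traces -/

lemma matrix_cfc_continuousOn (f : ℝ → ℝ) (S : Matrix X X ℂ) :
    ContinuousOn f (spectrum ℝ S) :=
  (Matrix.finite_real_spectrum (A := S)).continuousOn f

/-- A positive semidefinite matrix has a Hermitian pseudo-inverse commuting with it. -/
lemma exists_pseudoInverse {S : Matrix X X ℂ} (hS : S.PosSemidef) :
    ∃ Q : Matrix X X ℂ, Qᴴ = Q ∧ S * Q = Q * S ∧ S * Q * S = S := by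
  have hsa : IsSelfAdjoint S := hS.isHermitian
  have key : S = cfc (fun x : ℝ => x) S := (cfc_id' ℝ S).symm
  -- As `0⁻¹ = 0`, the identity `x * x⁻¹ * x = x` holds on the whole spectrum.
  refine ⟨cfc (fun x : ℝ => x⁻¹) S, ?_, ?_, ?_⟩
  · exact (cfc_predicate (R := ℝ) (fun x : ℝ => x⁻¹) S : IsSelfAdjoint _)
  · exact (cfc_commute_cfc (fun x : ℝ => x) (fun x : ℝ => x⁻¹) S |>.eq) |> fun h => by
      rwa [← key] at h
  · have h1 : cfc (fun x : ℝ => x * x⁻¹ * x) S = S * cfc (fun x : ℝ => x⁻¹) S * S := by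
      rw [cfc_mul _ _ S (matrix_cfc_continuousOn _ _) (matrix_cfc_continuousOn _ _),
        cfc_mul _ _ S (matrix_cfc_continuousOn _ _) (matrix_cfc_continuousOn _ _), ← key]
    rw [← h1]
    conv_rhs => rw [key]
    congr 1
    ext x
    exact mul_inv_mul_cancel x

lemma sqrt_posSemidef (A : Matrix X X ℂ) : (CFC.sqrt A).PosSemidef :=
  Matrix.nonneg_iff_posSemidef.mp (CFC.sqrt_nonneg A)

lemma sqrt_conjTranspose (A : Matrix X X ℂ) : (CFC.sqrt A)ᴴ = CFC.sqrt A :=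
  (sqrt_posSemidef A).isHermitian

lemma sqrt_mul_self {A : Matrix X X ℂ} (hA : A.PosSemidef) :
    CFC.sqrt A * CFC.sqrt A = A :=
  CFC.sqrt_mul_sqrt_self A (Matrix.nonneg_iff_posSemidef.mpr hA)

/-- `C Cᴴ` is an orthogonal projection, and so is its complement. -/
lemma self_mul_conjTranspose_le_one {C : Matrix X X ℂ} (hC : C * Cᴴ * C = C) :
    C * Cᴴ ≤ 1 := by
  rw [Matrix.le_iff]
  have h : (1 : Matrix X X ℂ) - C * Cᴴ = (1 - C * Cᴴ)ᴴ * (1 - C * Cᴴ) := by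
    have : C * Cᴴ * (C * Cᴴ) = C * Cᴴ := by rw [← Matrix.mul_assoc, hC]
    simp [sub_mul, mul_sub, this]
  rw [h]
  exact Matrix.posSemidef_conjTranspose_mul_self _

lemma conjTranspose_mul_self_le_one {C : Matrix X X ℂ} (hC : C * Cᴴ * C = C) :
    Cᴴ * C ≤ 1 := by
  have h : Cᴴ * Cᴴᴴ * Cᴴ = Cᴴ := by
    conv_rhs => rw [← hC]
    simp [Matrix.mul_assoc]
  simpa using self_mul_conjTranspose_le_one h

/-- If `Mᴴ M = S²` with `S` positive semidefinite, then `M = C S` for a partial isometry `C`. -/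
lemma exists_partialIsometry_factor {M S : Matrix X X ℂ} (hS : S.PosSemidef)
    (h : Mᴴ * M = S * S) : ∃ C : Matrix X X ℂ, M = C * S ∧ C * Cᴴ * C = C := by
  obtain ⟨Q, hQ, hc, hs⟩ := exists_pseudoInverse hS
  have hSh : Sᴴ = S := hS.isHermitian
  -- `Mᴴ M = S²` forces `M` to vanish wherever `S` does, in particular on the range of `1 - Q S`.
  have hM : M = M * Q * S := by
    have h0 : (M * (1 - Q * S))ᴴ * (M * (1 - Q * S)) = 0 := by
      have : S * (1 - Q * S) = 0 := by rw [mul_sub, ← Matrix.mul_assoc, hs]; simp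
      rw [Matrix.conjTranspose_mul, Matrix.mul_assoc, ← Matrix.mul_assoc Mᴴ, h,
        Matrix.mul_assoc S, this]
      simp
    have h1 := Matrix.conjTranspose_mul_self_eq_zero.mp h0
    rw [mul_sub, sub_eq_zero, mul_one, ← Matrix.mul_assoc] at h1
    exact h1
  refine ⟨M * Q, hM, ?_⟩
  rw [Matrix.conjTranspose_mul, hQ]
  calc M * Q * (Q * Mᴴ) * (M * Q) = M * Q * Q * (Mᴴ * M) * Q := by
        simp only [Matrix.mul_assoc]
    _ = M * Q * (Q * S) * (S * Q) := by rw [h]; simp only [Matrix.mul_assoc]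
    _ = M * Q * (S * Q * S) * Q := by rw [← hc]; simp only [Matrix.mul_assoc]
    _ = M * Q := by rw [hs, ← hM]

lemma trace_re_nonneg {A : Matrix X X ℂ} (hA : A.PosSemidef) : 0 ≤ A.trace.re :=
  (Complex.nonneg_iff.mp hA.trace_nonneg).1

lemma trace_re_mono {A B : Matrix X X ℂ} (h : A ≤ B) : A.trace.re ≤ B.trace.re := by
  have := trace_re_nonneg (Matrix.le_iff.mp h)
  rw [Matrix.trace_sub, Complex.sub_re] at this
  linarith

lemma trace_mul_re_nonneg {A B : Matrix X X ℂ} (hA : A.PosSemidef) (hB : B.PosSemidef) :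
    0 ≤ (A * B).trace.re := by
  rw [← sqrt_mul_self hA, Matrix.mul_assoc, Matrix.trace_mul_comm]
  have := hB.conjTranspose_mul_mul_same (CFC.sqrt A)
  rw [sqrt_conjTranspose] at this
  exact trace_re_nonneg this

lemma trace_conjTranspose_re (A : Matrix X X ℂ) : Aᴴ.trace.re = A.trace.re := by
  simp [Matrix.trace_conjTranspose]

lemma conj_mono {A B : Matrix X X ℂ} (h : A ≤ B) (C : Matrix X X ℂ) :
    C * A * Cᴴ ≤ C * B * Cᴴ := by
  rw [Matrix.le_iff] at h ⊢
  simpa [mul_sub, sub_mul] using h.mul_mul_conjTranspose_same C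

lemma conj_mono' {A B : Matrix X X ℂ} (h : A ≤ B) (C : Matrix X X ℂ) :
    Cᴴ * A * C ≤ Cᴴ * B * C := by
  simpa using conj_mono h Cᴴ

/-! ### Trace norm, fidelity and Powers–Størmer -/

/-- The trace norm dominates the pairing with any contraction. -/
lemma trace_mul_re_le_traceNorm {W M : Matrix X X ℂ} (hW : Wᴴ * W ≤ 1) :
    (W * M).trace.re ≤ traceNorm M := by
  set S := CFC.sqrt (Mᴴ * M) with hSdef
  have hS : S.PosSemidef := sqrt_posSemidef _
  obtain ⟨C, hMC, hC⟩ := exists_partialIsometry_factor (M := M) hS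
    (sqrt_mul_self (Matrix.posSemidef_conjTranspose_mul_self M)).symm
  set D := W * C with hD
  have hDD : Dᴴ * D ≤ 1 := by
    have h1 := conj_mono' hW C
    have h2 := conjTranspose_mul_self_le_one hC
    rw [hD, Matrix.conjTranspose_mul]
    simp only [Matrix.mul_assoc, Matrix.mul_one] at h1 h2 ⊢
    exact h1.trans h2
  -- This operator equals `2 - D - Dᴴ`; pairing it with `S` gives `Re tr (D S) ≤ tr S`.
  have hpos : ((1 - D)ᴴ * (1 - D) + (1 - Dᴴ * D)).PosSemidef :=
    (Matrix.posSemidef_conjTranspose_mul_self _).add (Matrix.le_iff.mp hDD)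
  have h3 := trace_mul_re_nonneg hpos hS
  have h4 : ((1 - D)ᴴ * (1 - D) + (1 - Dᴴ * D)) * S = S + S - D * S - Dᴴ * S := by
    simp [mul_sub, sub_mul, add_mul]
    abel
  have h5 : (Dᴴ * S).trace.re = (D * S).trace.re := by
    rw [← trace_conjTranspose_re, Matrix.conjTranspose_mul, Matrix.trace_mul_comm]
    simp [hS.isHermitian.eq]
  rw [h4] at h3
  simp only [Matrix.trace_sub, Matrix.trace_add, Complex.sub_re, Complex.add_re, h5] at h3
  have h6 : W * M = D * S := by rw [hMC, hD, Matrix.mul_assoc]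
  rw [h6, traceNorm, ← hSdef]
  linarith

/-- A lower bound on the fidelity of a state with its image under a single Kraus operator. -/
lemma trace_mul_re_le_fidelity_conj {ρ : Matrix X X ℂ} (hρ : ρ.PosSemidef)
    (G : Matrix X X ℂ) : (G * ρ).trace.re ≤ fidelity ρ (G * ρ * Gᴴ) := by
  have hσ : (G * ρ * Gᴴ).PosSemidef := hρ.mul_mul_conjTranspose_same G
  set s := CFC.sqrt ρ with hs
  set t := CFC.sqrt (G * ρ * Gᴴ) with ht
  have hss : s * s = ρ := sqrt_mul_self hρ
  have hsh : sᴴ = s := sqrt_conjTranspose _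
  have hth : tᴴ = t := sqrt_conjTranspose _
  -- Polar decomposition gives `G √ρ = t Cᴴ`, so `tr (G ρ) = tr (Cᴴ √ρ t)` pairs `√ρ t` with a
  -- contraction.
  obtain ⟨C, hMC, hC⟩ := exists_partialIsometry_factor (M := (G * s)ᴴ) (S := t)
    (sqrt_posSemidef _) (by
      rw [sqrt_mul_self hσ, ← hss, Matrix.conjTranspose_conjTranspose,
        Matrix.conjTranspose_mul, hsh]
      simp only [Matrix.mul_assoc])
  have hG : G * s = t * Cᴴ := by
    rw [← Matrix.conjTranspose_conjTranspose (G * s), hMC, Matrix.conjTranspose_mul, hth]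
  have hW : (Cᴴ)ᴴ * Cᴴ ≤ 1 := by simpa using self_mul_conjTranspose_le_one hC
  have := trace_mul_re_le_traceNorm (M := s * t) hW
  rw [fidelity]
  refine le_trans (le_of_eq ?_) this
  rw [← hss, ← Matrix.mul_assoc, hG, Matrix.trace_mul_comm, Matrix.trace_mul_comm Cᴴ,
    Matrix.mul_assoc]

/-- The Powers–Størmer inequality, in variational form. -/
lemma exists_contraction_powers_stormer {A B : Matrix X X ℂ} (hA : A.PosSemidef)
    (hB : B.PosSemidef) : ∃ Z : Matrix X X ℂ, Zᴴ * Z ≤ 1 ∧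
      A.trace.re + B.trace.re - (Z * (A - B)).trace.re
        ≤ 2 * (CFC.sqrt B * CFC.sqrt A).trace.re := by
  set a := CFC.sqrt A with ha
  set b := CFC.sqrt B with hb
  have haa : a * a = A := sqrt_mul_self hA
  have hbb : b * b = B := sqrt_mul_self hB
  have hpa : a.PosSemidef := sqrt_posSemidef _
  have hpb : b.PosSemidef := sqrt_posSemidef _
  set D := a - b with hD
  have hDsa : IsSelfAdjoint D := hpa.isHermitian.sub hpb.isHermitian
  have key : cfc (fun x : ℝ => x) D = D := cfc_id' ℝ D
  -- `Z` is the sign of `√A - √B`, with positive and negative parts `p` and `n`, so `Z D = |D| = p +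
  -- n`.
  set Z := cfc Real.sign D with hZ
  set p := cfc (fun x : ℝ => max x 0) D with hp
  set n := cfc (fun x : ℝ => max (-x) 0) D with hn
  have hcont := fun f : ℝ → ℝ => matrix_cfc_continuousOn f D
  have hpp : p.PosSemidef := Matrix.nonneg_iff_posSemidef.mp
    (cfc_nonneg fun x _ => le_max_right _ _)
  have hnp : n.PosSemidef := Matrix.nonneg_iff_posSemidef.mp
    (cfc_nonneg fun x _ => le_max_right _ _)
  have hpn : p - n = D := by
    rw [hp, hn, ← cfc_sub _ _ D (hcont _) (hcont _)]
    conv_rhs => rw [← key]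
    congr 1
    ext x
    rcases le_total x 0 with h | h <;> simp [h]
  have hZD : Z * D = p + n := by
    have : Z * cfc (fun x : ℝ => x) D = p + n := by
      rw [hp, hn, hZ, ← cfc_add D _ _ (hcont _) (hcont _), ← cfc_mul _ _ D (hcont _) (hcont _)]
      congr 1
      ext x
      rcases lt_trichotomy x 0 with h | h | h
      · simp [Real.sign_of_neg h, h.le]
      · simp [h]
      · simp [Real.sign_of_pos h, h.le]
    rwa [key] at this
  have hDZ : D * Z = p + n := by
    have := (cfc_commute_cfc (fun x : ℝ => x) Real.sign D).eq
    rw [key] at this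
    rw [hZ, this, ← hZ, hZD]
  have hZh : Zᴴ = Z := (cfc_predicate (R := ℝ) Real.sign D : IsSelfAdjoint _)
  refine ⟨Z, ?_, ?_⟩
  · rw [hZh, hZ, ← cfc_mul _ _ D (hcont _) (hcont _)]
    refine cfc_le_one _ D fun x _ => ?_
    rcases Real.sign_apply_eq x with h | h | h <;> simp [h]
  · have e1 : (Z * (A - B)).trace = ((p + n) * (a + b)).trace := by
      -- Symmetrized difference of squares, as `a` and `b` need not commute.
      have h1 : (2 : ℂ) • (Z * (A - B)) = Z * D * (a + b) + Z * (a + b) * D := by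
        rw [← haa, ← hbb, hD, two_smul]
        noncomm_ring
      have h2 : (Z * (a + b) * D).trace = ((p + n) * (a + b)).trace := by
        rw [Matrix.trace_mul_comm, ← Matrix.mul_assoc, hDZ]
      have h3 := congrArg Matrix.trace h1
      rw [Matrix.trace_smul, Matrix.trace_add, h2, hZD, smul_eq_mul, ← two_mul] at h3
      exact mul_left_cancel₀ two_ne_zero h3
    -- `D²` contributes `tr A + tr B - 2 tr (b a)`; the remaining terms have nonnegative trace.
    have e2 : (p + n) * (a + b) = D * D + (p * b + p * b) + (n * a + n * a) := by
      nth_rw 1 [← hpn]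
      rw [hD]
      noncomm_ring
    have e3 : (D * D).trace = A.trace + B.trace - (b * a).trace - (b * a).trace := by
      rw [hD, ← haa, ← hbb]
      simp only [sub_mul, mul_sub, Matrix.trace_sub]
      rw [Matrix.trace_mul_comm a b]
      ring
    have i1 := trace_mul_re_nonneg hpp hpb
    have i2 := trace_mul_re_nonneg hnp hpa
    rw [e1, e2]
    simp only [Matrix.trace_add, e3, Complex.add_re, Complex.sub_re]
    linarith

/-! ### Block operators and pinching -/

/-- The block-diagonal operator on `XY` with blocks `Z x` on `Y`. -/
def blockDiag (Z : X → Matrix Y Y ℂ) : Matrix (X × Y) (X × Y) ℂ :=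
  Matrix.of fun p q => if p.1 = q.1 then Z p.1 p.2 q.2 else 0

/-- The `x`-th diagonal block of an operator on `XY`. -/
def block (M : Matrix (X × Y) (X × Y) ℂ) (x : X) : Matrix Y Y ℂ :=
  M.submatrix (fun y => (x, y)) (fun y => (x, y))

lemma blockDiag_mul_apply (Z : X → Matrix Y Y ℂ) (M : Matrix (X × Y) (X × Y) ℂ)
    (x : X) (y : Y) (q : X × Y) :
    (blockDiag Z * M) (x, y) q = ∑ y', Z x y y' * M (x, y') q := by
  rw [Matrix.mul_apply, Fintype.sum_prod_type, Finset.sum_eq_single x]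
  · simp [blockDiag]
  · intro b _ hb
    simp [blockDiag, hb.symm]
  · simp

lemma mul_blockDiag_apply (Z : X → Matrix Y Y ℂ) (M : Matrix (X × Y) (X × Y) ℂ)
    (x : X) (y : Y) (p : X × Y) :
    (M * blockDiag Z) p (x, y) = ∑ y', M p (x, y') * Z x y' y := by
  rw [Matrix.mul_apply, Fintype.sum_prod_type, Finset.sum_eq_single x]
  · simp [blockDiag]
  · intro b _ hb
    simp [blockDiag, hb]
  · simp

lemma blockDiag_conjTranspose (Z : X → Matrix Y Y ℂ) :
    (blockDiag Z)ᴴ = blockDiag fun x => (Z x)ᴴ := by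
  ext ⟨x, y⟩ ⟨x', y'⟩
  by_cases h : x = x'
  · subst h; simp [blockDiag]
  · simp [blockDiag, h, Ne.symm h]

lemma blockDiag_mul (Z W : X → Matrix Y Y ℂ) :
    blockDiag Z * blockDiag W = blockDiag fun x => Z x * W x := by
  ext ⟨x, y⟩ ⟨x', y'⟩
  rw [blockDiag_mul_apply]
  by_cases h : x = x'
  · subst h; simp [blockDiag, Matrix.mul_apply]
  · simp [blockDiag, h]

lemma blockDiag_sub (Z W : X → Matrix Y Y ℂ) :
    blockDiag Z - blockDiag W = blockDiag fun x => Z x - W x := by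
  ext ⟨x, y⟩ ⟨x', y'⟩
  by_cases h : x = x' <;> simp [blockDiag, h]

lemma blockDiag_const (σ : Matrix Y Y ℂ) :
    blockDiag (fun _ => σ) = (1 : Matrix X X ℂ) ⊗ₖ σ := by
  ext ⟨x, y⟩ ⟨x', y'⟩
  simp [blockDiag, Matrix.one_apply]

lemma blockDiag_one : blockDiag (fun _ : X => (1 : Matrix Y Y ℂ)) = 1 := by
  rw [blockDiag_const, Matrix.one_kronecker_one]

lemma block_blockDiag (Z : X → Matrix Y Y ℂ) (x : X) : block (blockDiag Z) x = Z x := by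
  ext y y'
  simp [block, blockDiag]

lemma trace_eq_sum_block (M : Matrix (X × Y) (X × Y) ℂ) :
    M.trace = ∑ x, (block M x).trace := by
  simp [Matrix.trace, block, Fintype.sum_prod_type]

lemma block_blockDiag_mul (Z : X → Matrix Y Y ℂ) (M : Matrix (X × Y) (X × Y) ℂ) (x : X) :
    block (blockDiag Z * M) x = Z x * block M x := by
  ext y y'
  simp only [block, Matrix.submatrix_apply, blockDiag_mul_apply]
  rfl

lemma block_mul_blockDiag (Z : X → Matrix Y Y ℂ) (M : Matrix (X × Y) (X × Y) ℂ) (x : X) :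
    block (M * blockDiag Z) x = block M x * Z x := by
  ext y y'
  simp only [block, Matrix.submatrix_apply, mul_blockDiag_apply]
  rfl

lemma blockDiag_posSemidef {Z : X → Matrix Y Y ℂ} (hZ : ∀ x, (Z x).PosSemidef) :
    (blockDiag Z).PosSemidef := by
  have : blockDiag Z = (blockDiag fun x => CFC.sqrt (Z x))ᴴ *
      blockDiag fun x => CFC.sqrt (Z x) := by
    simp [blockDiag_conjTranspose, blockDiag_mul, sqrt_conjTranspose, sqrt_mul_self (hZ _)]
  rw [this]
  exact Matrix.posSemidef_conjTranspose_mul_self _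

lemma blockDiag_mono {Z W : X → Matrix Y Y ℂ} (h : ∀ x, Z x ≤ W x) :
    blockDiag Z ≤ blockDiag W := by
  rw [Matrix.le_iff, blockDiag_sub]
  exact blockDiag_posSemidef fun x => Matrix.le_iff.mp (h x)

lemma block_posSemidef {M : Matrix (X × Y) (X × Y) ℂ} (hM : M.PosSemidef) (x : X) :
    (block M x).PosSemidef :=
  hM.submatrix _

/-- The pinching inequality for the standard basis of `X`. -/
lemma le_card_smul_blockDiag_block {M : Matrix (X × Y) (X × Y) ℂ} (hM : M.PosSemidef) :
    M ≤ (Fintype.card X : ℝ) • blockDiag (block M) := by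
  set G : X → Matrix (X × Y) (X × Y) ℂ := fun x => blockDiag (Pi.single x 1) with hG
  have hGh : ∀ x, (G x)ᴴ = G x := by
    intro x
    rw [hG]
    simp only [blockDiag_conjTranspose]
    congr 1
    funext z
    by_cases h : z = x
    · subst h; simp
    · simp [h]
  have hG1 : ∑ x, G x = 1 := by
    ext ⟨x, y⟩ ⟨x', y'⟩
    rw [← blockDiag_one, Matrix.sum_apply]
    by_cases h : x = x'
    · subst h
      simp only [hG, blockDiag, Matrix.of_apply, if_true]
      rw [Finset.sum_eq_single x]
      · simp
      · intro b _ hb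
        simp [hb.symm]
      · simp
    · simp [hG, blockDiag, h]
  have hGM : ∑ x, G x * M * G x = blockDiag (block M) := by
    ext ⟨x, y⟩ ⟨x', y'⟩
    rw [Matrix.sum_apply, Finset.sum_eq_single x]
    · simp only [hG, mul_blockDiag_apply, blockDiag_mul_apply]
      by_cases h : x = x'
      · subst h
        simp [blockDiag, block, Matrix.one_apply]
      · simp [blockDiag, h, Ne.symm h]
    · intro b _ hb
      simp [hG, mul_blockDiag_apply, blockDiag_mul_apply, hb.symm]
    · simp
  -- The diagonal terms give `|X|` times the pinching, twice; the cross terms give `M`, twice, since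
  -- `∑ x, G x = 1`.
  have hsum : ∑ x, ∑ z, (G x - G z) * M * (G x - G z)ᴴ =
      (2 : ℝ) • ((Fintype.card X : ℝ) • blockDiag (block M) - M) := by
    have e1 : ∀ x z, (G x - G z) * M * (G x - G z)ᴴ =
        G x * M * G x + G z * M * G z - (G x * M * G z + G z * M * G x) := by
      intro x z
      rw [Matrix.conjTranspose_sub, hGh, hGh]
      noncomm_ring
    have e2 : ∑ x, ∑ z, G x * M * G z = M := by
      simp_rw [← Matrix.mul_sum, hG1, ← Matrix.sum_mul, hG1]
      simp
    have e3 : ∑ x, ∑ z, G z * M * G x = M := by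
      rw [Finset.sum_comm, e2]
    have e4 : ∑ x, ∑ _z : X, G x * M * G x = (Fintype.card X : ℝ) • blockDiag (block M) := by
      simp only [Finset.sum_const, Finset.card_univ, ← Nat.cast_smul_eq_nsmul ℝ]
      rw [← Finset.smul_sum, hGM]
    have e5 : ∑ _x : X, ∑ z, G z * M * G z = (Fintype.card X : ℝ) • blockDiag (block M) := by
      rw [Finset.sum_comm, e4]
    simp only [e1, Finset.sum_sub_distrib, Finset.sum_add_distrib]
    rw [e2, e3, e4, e5, two_smul]
    abel
  have hpos : (∑ x, ∑ z, (G x - G z) * M * (G x - G z)ᴴ).PosSemidef :=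
    Matrix.posSemidef_sum _ fun x _ => Matrix.posSemidef_sum _ fun z _ =>
      hM.mul_mul_conjTranspose_same _
  rw [hsum] at hpos
  have := hpos.smul (show (0 : ℝ) ≤ 1 / 2 by norm_num)
  rw [smul_smul] at this
  rw [Matrix.le_iff]
  simpa using this

lemma measure_eq_blockDiag {A₁ : Type u} {A₂ : Type v} {E : Type w} [Fintype A₁]
    [DecidableEq A₁] [Fintype A₂] [DecidableEq A₂] [Fintype E] [DecidableEq E]
    (M : Matrix ((A₁ × A₂) × E) ((A₁ × A₂) × E) ℂ) :
    measure M = blockDiag fun a => ∑ b, block M (a, b) := by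
  ext ⟨a, e⟩ ⟨a', e'⟩
  by_cases h : a = a'
  · subst h
    simp [measure, blockDiag, block, Matrix.sum_apply]
  · simp [measure, blockDiag, h]

lemma reduced_eq_sum_block (M : Matrix (X × Y) (X × Y) ℂ) : reduced M = ∑ x, block M x := by
  ext y y'
  simp [reduced, block, Matrix.sum_apply]

lemma reduced_isState {ρ : Matrix (X × Y) (X × Y) ℂ} (hρ : IsState ρ) :
    IsState (reduced ρ) := by
  rw [reduced_eq_sum_block]
  refine ⟨Matrix.posSemidef_sum _ fun x _ => block_posSemidef hρ.1 x, ?_⟩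
  rw [Matrix.trace_sum, ← trace_eq_sum_block, hρ.2]

/-! ### Construction of the Kraus operator -/

/-- For positive semidefinite `ω`, `τ` there is a `K` with `K ω K† ≤ τ` and `tr (K ω)` equal to
`tr (√τ √ω)`. -/
lemma exists_transfer {ω τ : Matrix Y Y ℂ} (hω : ω.PosSemidef) (hτ : τ.PosSemidef) :
    ∃ K : Matrix Y Y ℂ, K * ω * Kᴴ ≤ τ ∧
      (K * ω).trace = (CFC.sqrt τ * CFC.sqrt ω).trace := by
  obtain ⟨Q, hQ, hc, hs⟩ := exists_pseudoInverse (sqrt_posSemidef ω)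
  set s := CFC.sqrt ω with hsd
  have hss : s * s = ω := sqrt_mul_self hω
  have hsh : sᴴ = s := sqrt_conjTranspose _
  have hP : Q * s * (Q * s)ᴴ ≤ 1 := by
    have hPh : (Q * s)ᴴ = Q * s := by rw [Matrix.conjTranspose_mul, hQ, hsh, hc]
    have hPP : Q * s * (Q * s) = Q * s := by
      rw [Matrix.mul_assoc, ← Matrix.mul_assoc s, hs]
    exact self_mul_conjTranspose_le_one (by rw [hPh, hPP, hPP])
  have h := conj_mono hP (CFC.sqrt τ)
  -- `Q` inverts `√ω` on its support, so `K √ω` is `√τ` times the support projection `Q s`.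
  refine ⟨CFC.sqrt τ * Q, ?_, ?_⟩
  · rw [Matrix.mul_one, sqrt_conjTranspose, sqrt_mul_self hτ] at h
    rw [← hss]
    simpa [Matrix.mul_assoc, hsh, sqrt_conjTranspose] using h
  · rw [← hss, Matrix.mul_assoc, ← Matrix.mul_assoc Q, ← hc, hs]

variable {A₁ : Type u} {A₂ : Type v} {E : Type w} [Fintype A₁] [DecidableEq A₁]
  [Fintype A₂] [DecidableEq A₂] [Fintype E] [DecidableEq E]

lemma applyUnitary_isState {X : Type u} {Y : Type v} [Fintype X] [DecidableEq X] [Fintype Y]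
    [DecidableEq Y] (U : Matrix.unitaryGroup X ℂ) {ρ : Matrix (X × Y) (X × Y) ℂ}
    (hρ : IsState ρ) : IsState (applyUnitary U ρ) := by
  refine ⟨hρ.1.mul_mul_conjTranspose_same _, ?_⟩
  have hU : (U : Matrix X X ℂ)ᴴ * U = 1 := Matrix.mem_unitaryGroup_iff'.mp U.2
  rw [applyUnitary, Matrix.trace_mul_comm, ← Matrix.mul_assoc, Matrix.conjTranspose_kronecker,
    ← Matrix.mul_kronecker_mul, hU]
  simp [hρ.2]

/-- If the outcome of measuring `A₁` is close to `1 / |A₁| ⊗ σ`, some block-diagonal Kraus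
operator `K` maps `ρ` to a subnormalized operator dominated by `|A₂| • 1 ⊗ σ`, with a large value
of `tr (K ρ)`. -/
lemma exists_kraus_of_measure_close {ρ : Matrix ((A₁ × A₂) × E) ((A₁ × A₂) × E) ℂ}
    (hρ : IsState ρ) {σ : Matrix E E ℂ} (hσ : IsState σ) {ε : ℝ}
    (h : traceNorm (measure ρ -
      ((1 / (Fintype.card A₁ : ℂ)) • (1 : Matrix A₁ A₁ ℂ)) ⊗ₖ σ) ≤ ε) :
    ∃ K : Matrix ((A₁ × A₂) × E) ((A₁ × A₂) × E) ℂ,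
      1 - ε / 2 ≤ (K * ρ).trace.re ∧ (K * ρ * Kᴴ).trace.re ≤ 1 ∧
      K * ρ * Kᴴ ≤ (Fintype.card A₂ : ℝ) • ((1 : Matrix (A₁ × A₂) (A₁ × A₂) ℂ) ⊗ₖ σ) := by
  have hne : Nonempty A₁ := by
    by_contra hne
    rw [not_nonempty_iff] at hne
    have := hρ.2
    simp [Matrix.trace] at this
  have hcard : (Fintype.card A₁ : ℝ) ≠ 0 := by
    exact_mod_cast Fintype.card_ne_zero
  set τ : Matrix E E ℂ := (1 / (Fintype.card A₁ : ℝ)) • σ with hτ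
  have hτp : τ.PosSemidef := hσ.1.smul (by positivity)
  have hτt : τ.trace.re = 1 / (Fintype.card A₁ : ℝ) := by
    rw [hτ, Matrix.trace_smul, hσ.2]
    simp
  have hideal : ((1 / (Fintype.card A₁ : ℂ)) • (1 : Matrix A₁ A₁ ℂ)) ⊗ₖ σ =
      blockDiag fun _ => τ := by
    rw [blockDiag_const, Matrix.smul_kronecker, hτ]
    ext p q
    simp [Matrix.kroneckerMap_apply, mul_left_comm]
  set ω : A₁ → Matrix E E ℂ := fun a => ∑ b, block ρ (a, b) with hω
  have hωp : ∀ a, (ω a).PosSemidef := fun a =>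
    Matrix.posSemidef_sum _ fun b _ => block_posSemidef hρ.1 _
  have hωt : ∑ a, (ω a).trace.re = 1 := by
    have := congrArg Complex.re hρ.2
    rw [trace_eq_sum_block, Fintype.sum_prod_type] at this
    simpa [hω, Matrix.trace_sum] using this
  have hτsum : ∑ _a : A₁, τ.trace.re = 1 := by
    rw [hτt]
    simp [hcard]
  rw [measure_eq_blockDiag, hideal, blockDiag_sub] at h
  choose k hk hkt using fun a => exists_transfer (hωp a) hτp
  choose Z hZ hZt using fun a => exists_contraction_powers_stormer (hωp a) hτp
  have hZc : (blockDiag Z)ᴴ * blockDiag Z ≤ 1 := by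
    rw [blockDiag_conjTranspose, blockDiag_mul, ← blockDiag_one]
    exact blockDiag_mono hZ
  have hnorm := (trace_mul_re_le_traceNorm (M := blockDiag fun a => ω a - τ) hZc).trans h
  rw [blockDiag_mul, trace_eq_sum_block] at hnorm
  simp only [block_blockDiag, Complex.re_sum] at hnorm
  -- `k` depends on `a` only, so conjugation by `K` commutes with summing the blocks over `b`.
  set K : Matrix ((A₁ × A₂) × E) ((A₁ × A₂) × E) ℂ := blockDiag fun x => k x.1 with hK
  have hblock : ∀ x, block (K * ρ * Kᴴ) x = k x.1 * block ρ x * (k x.1)ᴴ := fun x => by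
    rw [hK, blockDiag_conjTranspose, block_mul_blockDiag, block_blockDiag_mul]
  have hsumblock : ∀ a, ∑ b, block (K * ρ * Kᴴ) (a, b) = k a * ω a * (k a)ᴴ := fun a => by
    simp only [hblock, hω, Matrix.mul_sum, Matrix.sum_mul]
  have hpos : (K * ρ * Kᴴ).PosSemidef := hρ.1.mul_mul_conjTranspose_same K
  refine ⟨K, ?_, ?_, ?_⟩
  · have e : (K * ρ).trace.re = ∑ a, (CFC.sqrt τ * CFC.sqrt (ω a)).trace.re := by
      rw [trace_eq_sum_block, Fintype.sum_prod_type, Complex.re_sum]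
      refine Finset.sum_congr rfl fun a _ => ?_
      simp only [hK, block_blockDiag_mul]
      rw [← Matrix.trace_sum, ← Matrix.mul_sum, ← hkt]
    have hs := Finset.sum_le_sum fun a (_ : a ∈ Finset.univ) => hZt a
    rw [Finset.sum_sub_distrib, Finset.sum_add_distrib, hωt, hτsum, ← Finset.mul_sum,
      ← e] at hs
    linarith
  · rw [trace_eq_sum_block, Fintype.sum_prod_type, Complex.re_sum, ← hτsum]
    refine Finset.sum_le_sum fun a _ => ?_
    rw [← Matrix.trace_sum, hsumblock]
    exact trace_re_mono (hk a)
  · have hle : ∀ x, block (K * ρ * Kᴴ) x ≤ τ := fun x => by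
      refine le_trans ?_ (hk x.1)
      rw [← hsumblock]
      exact Finset.single_le_sum (f := fun b => block (K * ρ * Kᴴ) (x.1, b))
        (fun b _ => (block_posSemidef hpos _).nonneg) (Finset.mem_univ x.2)
    have h1 := le_card_smul_blockDiag_block hpos
    have h2 := blockDiag_mono hle
    rw [Matrix.le_iff] at h2
    have h3 := h2.smul (show (0 : ℝ) ≤ Fintype.card (A₁ × A₂) by positivity)
    rw [smul_sub] at h3
    refine (h1.trans (Matrix.le_iff.mpr h3)).trans (le_of_eq ?_)
    rw [blockDiag_const, hτ, Matrix.kronecker_smul, smul_smul]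
    congr 1
    rw [Fintype.card_prod]
    push_cast
    field_simp

/-- The conclusion of `exists_kraus_of_measure_close` when a unitary precedes the measurement. -/
lemma exists_kraus_of_applyUnitary_close {ρ : Matrix ((A₁ × A₂) × E) ((A₁ × A₂) × E) ℂ}
    (hρ : IsState ρ) {σ : Matrix E E ℂ} (hσ : IsState σ)
    (U : Matrix.unitaryGroup (A₁ × A₂) ℂ) {ε : ℝ}
    (h : traceNorm (measure (applyUnitary U ρ) -
      ((1 / (Fintype.card A₁ : ℂ)) • (1 : Matrix A₁ A₁ ℂ)) ⊗ₖ σ) ≤ ε) :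
    ∃ G : Matrix ((A₁ × A₂) × E) ((A₁ × A₂) × E) ℂ,
      1 - ε / 2 ≤ (G * ρ).trace.re ∧ (G * ρ * Gᴴ).trace.re ≤ 1 ∧
      G * ρ * Gᴴ ≤ (Fintype.card A₂ : ℝ) • ((1 : Matrix (A₁ × A₂) (A₁ × A₂) ℂ) ⊗ₖ σ) := by
  obtain ⟨K, h1, h2, h3⟩ := exists_kraus_of_measure_close (applyUnitary_isState U hρ) hσ h
  set V := (U : Matrix (A₁ × A₂) (A₁ × A₂) ℂ) ⊗ₖ (1 : Matrix E E ℂ) with hV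
  have hU : (U : Matrix (A₁ × A₂) (A₁ × A₂) ℂ)ᴴ * U = 1 := Matrix.mem_unitaryGroup_iff'.mp U.2
  have hU' : (U : Matrix (A₁ × A₂) (A₁ × A₂) ℂ) * Uᴴ = 1 := Matrix.mem_unitaryGroup_iff.mp U.2
  have hVV : V * Vᴴ = 1 := by
    rw [hV, Matrix.conjTranspose_kronecker, ← Matrix.mul_kronecker_mul, hU']
    simp
  have hσV : Vᴴ * ((1 : Matrix (A₁ × A₂) (A₁ × A₂) ℂ) ⊗ₖ σ) * V =
      (1 : Matrix (A₁ × A₂) (A₁ × A₂) ℂ) ⊗ₖ σ := by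
    rw [hV, Matrix.conjTranspose_kronecker, ← Matrix.mul_kronecker_mul,
      ← Matrix.mul_kronecker_mul, Matrix.mul_one, hU]
    simp
  have hG : Vᴴ * K * V * ρ * (Vᴴ * K * V)ᴴ = Vᴴ * (K * applyUnitary U ρ * Kᴴ) * V := by
    simp only [applyUnitary, Matrix.conjTranspose_mul, Matrix.conjTranspose_conjTranspose,
      Matrix.mul_assoc, ← hV]
  refine ⟨Vᴴ * K * V, ?_, ?_, ?_⟩
  · refine h1.trans (le_of_eq ?_)
    rw [Matrix.mul_assoc, Matrix.mul_assoc, Matrix.trace_mul_comm Vᴴ, applyUnitary]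
    simp only [Matrix.mul_assoc, ← hV]
  · rw [hG, Matrix.trace_mul_comm, ← Matrix.mul_assoc, hVV, Matrix.one_mul]
    exact h2
  · rw [hG]
    refine (conj_mono' h3 V).trans (le_of_eq ?_)
    rw [Matrix.mul_smul, Matrix.smul_mul, hσV]

/-! ### The entropy bound -/

lemma le_smoothMinEntropy_of_extractionError_le
    {ρ : Matrix ((A₁ × A₂) × E) ((A₁ × A₂) × E) ℂ} (hρ : IsState ρ) {L : ℕ} (hL : 0 < L)
    (U : Fin L → Matrix.unitaryGroup (A₁ × A₂) ℂ) {ε : ℝ} (h : extractionError U ρ ≤ ε) :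
    (Real.logb 2 (Fintype.card A₁) : EReal) ≤
      (Real.logb 2 (Fintype.card (A₁ × A₂)) : EReal) + smoothMinEntropy (Real.sqrt ε) ρ := by
  have hne : Nonempty (A₁ × A₂) := by
    by_contra hne
    rw [not_nonempty_iff] at hne
    have := hρ.2
    simp [Matrix.trace] at this
  obtain ⟨hne₁, hne₂⟩ := nonempty_prod.mp hne
  have hLpos : (0 : ℝ) < L := by exact_mod_cast hL
  obtain ⟨i, -, hi⟩ : ∃ i ∈ (Finset.univ : Finset (Fin L)),
      traceNorm (measure (applyUnitary (U i) ρ) -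
        ((1 / (Fintype.card A₁ : ℂ)) • (1 : Matrix A₁ A₁ ℂ)) ⊗ₖ reduced ρ) ≤ ε := by
    refine Finset.exists_le_of_sum_le ⟨⟨0, hL⟩, Finset.mem_univ _⟩ ?_
    rw [extractionError, one_div, inv_mul_le_iff₀ hLpos] at h
    simpa using h
  have hσ := reduced_isState hρ
  obtain ⟨G, h1, h2, h3⟩ := exists_kraus_of_applyUnitary_close hρ hσ (U i) hi
  have hmem : G * ρ * Gᴴ ∈ stateBall (Real.sqrt ε) ρ := by
    refine ⟨⟨hρ.1.mul_mul_conjTranspose_same G, h2⟩, Real.sqrt_le_sqrt ?_⟩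
    have hF : 1 - ε / 2 ≤ genFidelity ρ (G * ρ * Gᴴ) :=
      (h1.trans (trace_mul_re_le_fidelity_conj hρ.1 G)).trans
        (le_add_of_nonneg_right (Real.sqrt_nonneg _))
    -- If `ε ≤ 2`, the fidelity bound can be squared; otherwise `1 - F² ≤ 1 ≤ ε` trivially.
    rcases le_total 0 (1 - ε / 2) with h0 | h0
    · nlinarith [pow_le_pow_left₀ h0 hF 2, sq_nonneg ε]
    · nlinarith [sq_nonneg (genFidelity ρ (G * ρ * Gᴴ))]
  set l : ℝ := -Real.logb 2 (Fintype.card A₂) with hl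
  have hpow : (2 : ℝ) ^ (-l) = Fintype.card A₂ := by
    rw [hl, neg_neg]
    exact Real.rpow_logb (by norm_num) (by norm_num) (by exact_mod_cast Fintype.card_pos)
  have hrel : (l : EReal) ≤ smoothMinEntropy (Real.sqrt ε) ρ :=
    le_iSup₂_of_le (f := fun τ (_ : τ ∈ stateBall (Real.sqrt ε) ρ) => minEntropy τ) _ hmem <|
      le_iSup₂_of_le (f := fun σ (_ : IsState σ) => minEntropyRel (G * ρ * Gᴴ) σ) _ hσ <|
        le_iSup₂_of_le (f := fun (l : ℝ)
          (_ : G * ρ * Gᴴ ≤ ((2 : ℝ) ^ (-l)) • ((1 : Matrix (A₁ × A₂) (A₁ × A₂) ℂ) ⊗ₖ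
            reduced ρ)) => (l : EReal)) l (by rw [hpow]; exact h3) le_rfl
  refine le_trans (le_of_eq ?_) (add_le_add_right hrel _)
  rw [← EReal.coe_add, Fintype.card_prod, Nat.cast_mul,
    Real.logb_mul (by exact_mod_cast Fintype.card_ne_zero)
      (by exact_mod_cast Fintype.card_ne_zero), hl]
  congr 1
  ring

end QInfo

theorem proposition5 {A₁ : Type u} {A₂ : Type v} {E : Type w}
    [Fintype A₁] [DecidableEq A₁] [Fintype A₂] [DecidableEq A₂] [Fintype E] [DecidableEq E]
    (ρ : Matrix ((A₁ × A₂) × E) ((A₁ × A₂) × E) ℂ) (hρ : QInfo.IsState ρ)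
    {L : ℕ} (hL : 0 < L) (U : Fin L → Matrix.unitaryGroup (A₁ × A₂) ℂ) (ε : ℝ) :
    (QInfo.extractionError U ρ ≤ ε →
      (Real.logb 2 (Fintype.card A₁) : EReal) ≤
        (Real.logb 2 (Fintype.card (A₁ × A₂)) : EReal) +
          QInfo.smoothMinEntropy (Real.sqrt ε) ρ) ∧
    (∀ k : ℝ, QInfo.IsQCExtractor.{u, v, w} k ε U → (k : EReal) ≤ QInfo.minEntropy ρ →
      (Real.logb 2 (Fintype.card A₁) : EReal) ≤
        (Real.logb 2 (Fintype.card (A₁ × A₂)) : EReal) +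
          QInfo.smoothMinEntropy (Real.sqrt ε) ρ) :=
  ⟨QInfo.le_smoothMinEntropy_of_extractionError_le hρ hL U, fun _ hext hk =>
    QInfo.le_smoothMinEntropy_of_extractionError_le hρ hL U (hext.2.2.2.2 E ρ hρ hk)⟩
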